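/- Let $q>2$ be a prime power, let $K=\mathbb F_q$, and let $x_0,x_1,x_2,\dots$ be elements of an extension field of $K$ such that $x_0$ is transcendental over $K$ and $$x_{i+1}^{q-1}+(x_i+1)^{q-1}=1\qquad\text{for all } i\ge 0 .$$ For $n\ge 0$ put $F_n=K(x_0,\dots,x_n)$. A place of $F_n$ is given by a valuation ring $\mathcal O$ with $K\subseteq\mathcal O\subsetneq F_n$, and it is a zero of $z\in F_n$ if $z$ lies in the maximal ideal of $\mathcal O$. Let $n\ge 0$ and $t$ be integers with $-1\le t<n$, let $\alpha\in\mathbb F_q^*\setminus\{-1\}$, and let $Q$ be a place of $F_n$ that is a zero of $x_{t+1}-\alpha$. (i) If $n<2t+2$, then $Q$ is unramified in $F_{n+1}$, i.e. every place of $F_{n+1}$ lying over $Q$ has ramification index $1$ over $Q$. (ii) If $n\ge 2t+2$, then $Q$ is ramified in $F_{n+1}$ (some place of $F_{n+1}$ over $Q$ has ramification index greater than $1$), and every place of $F_{n+1}$ lying over $Q$ has ramification index $q-1$ over $Q$. -/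

import Mathlib

/-- A place of a field `F` over a constant field `K`, given by its valuation ring: a valuation
ring of `F` that contains the image of `K` and is different from `F`. -/
structure Place (K F : Type*) [Field K] [Field F] [Algebra K F] where
  /-- the valuation ring of the place -/
  ring : ValuationSubring F
  algebraMap_mem : ∀ c : K, algebraMap K F c ∈ ring
  ne_top : ring ≠ ⊤

namespace Place

variable {K F F' : Type*} [Field K] [Field F] [Field F'] [Algebra K F] [Algebra K F']

/-- `Q` is a zero of `z`: the function `z` lies in the maximal ideal of the valuation ring of `Q`,
that is, `z` has positive order at `Q` (in Mathlib's multiplicative notation, valuation `< 1`). -/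
def IsZero (Q : Place K F) (z : F) : Prop :=
  Q.ring.valuation z < 1

/-- The place `Q'` of the extension field `F'` lies over the place `Q` of `F`:
the valuation ring of `Q` is the intersection of that of `Q'` with `F`. -/
def LiesOver (f : F →ₐ[K] F') (Q' : Place K F') (Q : Place K F) : Prop :=
  Q'.ring.comap (f : F →+* F') = Q.ring

/-- The ramification index of `Q'` in the extension `F' / F`: the index
`[v'(F'ˣ) : v'(Fˣ)]` of the value group of the restriction to `F` of the valuation `v'` of `Q'`
in the value group of `v'`.  When `Q'` lies over `Q` and both are discrete, with normalized
valuations `ord'` and `ord`, this is the number `e ≥ 1` with `ord' (f z) = e * ord z` for all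
nonzero `z` in `F`. -/
noncomputable def ramificationIndex (f : F →ₐ[K] F') (Q' : Place K F') : ℕ :=
  (((Units.map (Q'.ring.valuation : F' →* Q'.ring.ValueGroup)).comp
    (Units.map (f : F →* F'))).range).index

/-- `Q` is unramified in `F'`: every place over `Q` has ramification index `1`. -/
def IsUnramifiedIn (f : F →ₐ[K] F') (Q : Place K F) : Prop :=
  ∀ Q' : Place K F', LiesOver f Q' Q → ramificationIndex f Q' = 1

/-- `Q` is ramified in `F'`: some place over `Q` has ramification index greater than `1`. -/
def IsRamifiedIn (f : F →ₐ[K] F') (Q : Place K F) : Prop :=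
  ∃ Q' : Place K F', LiesOver f Q' Q ∧ 1 < ramificationIndex f Q'

end Place

namespace KummerTower

/-- The sequence `x₀, x₁, x₂, …` generating the tower over `K = 𝔽_q`: the element `x₀` is
transcendental over `K` and `x_{i+1}^(q-1) + (x_i + 1)^(q-1) = 1` for all `i`. -/
structure IsGeneratingSequence (K : Type*) {E : Type*} [Field K] [Field E] [Algebra K E]
    (x : ℕ → E) : Prop where
  transcendental : Transcendental K (x 0)
  relation : ∀ i : ℕ, x (i + 1) ^ (Nat.card K - 1) + (x i + 1) ^ (Nat.card K - 1) = 1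

/-- The function field `F_n = K(x₀, …, x_n)`. -/
def level (K : Type*) {E : Type*} [Field K] [Field E] [Algebra K E] (x : ℕ → E) (n : ℕ) :
    IntermediateField K E :=
  IntermediateField.adjoin K (x '' Set.Iic n)

/-- The generator `x_i` as an element of `F_n`, for `i ≤ n`. -/
def gen (K : Type*) {E : Type*} [Field K] [Field E] [Algebra K E] (x : ℕ → E) {n i : ℕ}
    (h : i ≤ n) : level K x n :=
  ⟨x i, IntermediateField.subset_adjoin K _ ⟨i, h, rfl⟩⟩

/-- The inclusion of `F_n` in `F_{n+1}`. -/
def step (K : Type*) {E : Type*} [Field K] [Field E] [Algebra K E] (x : ℕ → E) (n : ℕ) :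
    level K x n →ₐ[K] level K x (n + 1) :=
  IntermediateField.inclusion (IntermediateField.adjoin.mono K _ _
    (Set.image_mono (Set.Iic_subset_Iic.mpr n.le_succ)))

end KummerTower

/-! Put `T = t + 1`, extend a place over `Q` to a valuation `v` of `E`, and let `b` be `x 0` minus
its residue. Since `y - y ^ q` is additive and vanishes on `𝔽_q`, `1 - y ^ (q - 1)` has the same
value as `y - β` near a nonzero `β` of `𝔽_q`. The relation therefore forces `x j` to reduce to `-1`
for `j < T` and to `0` for `j > T`. Passing from `j` to `j + 1` multiplies the order of `x j` minus
its residue by `q - 1` below `T`, and divides it by `q - 1` from `T` on. If `b` has order 1, these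
orders are `(q - 1) ^ j` for `j ≤ T` and `(q - 1) ^ (2T - j)` for `T ≤ j ≤ 2T`.

Up to level `2T`, each `x (i + 1)` is thus a power of `b` times a unit whose `(q - 1)`-th power lies
in `F_i`. As `q - 1` is prime to the characteristic, such a Kummer step is unramified
(`exists_zpow_of_unramified`). At level `2T` the orders are back to 1, and from there each `x (i +
1)` has as its `(q - 1)`-th power a uniformizer of `F_i`, so every step is totally ramified
(`exists_zpow_of_ramified`). Induction along the tower (`exists_zpow_of_le`, `exists_zpow_of_ge`)
gives a generator of each value group, and `Place.ramificationIndex_eq` reads off the index. -/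

namespace Valuation

/-! ### Value groups of simple extensions. -/

open Polynomial IntermediateField

variable {F E Γ₀ : Type*} [Field F] [Field E] [Algebra F E] [LinearOrderedCommGroupWithZero Γ₀]

/-- The valuation ring of the restriction to `F` of a valuation `v` of the extension `E`. -/
abbrev restrictedRing (F : Type*) {E Γ₀ : Type*} [Field F] [Field E] [Algebra F E]
    [LinearOrderedCommGroupWithZero Γ₀] (v : Valuation E Γ₀) : ValuationSubring F :=
  (v.comap (algebraMap F E)).valuationSubring

/-- The embedding in `E` of the valuation ring of the restriction of `v` to `F`. -/
abbrev restrictedRingHom (F : Type*) {E Γ₀ : Type*} [Field F] [Field E] [Algebra F E]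
    [LinearOrderedCommGroupWithZero Γ₀] (v : Valuation E Γ₀) : v.restrictedRing F →+* E :=
  (algebraMap F E).comp (v.restrictedRing F).subtype

theorem restrictedRingHom_le_one (v : Valuation E Γ₀) (a : v.restrictedRing F) :
    v (v.restrictedRingHom F a) ≤ 1 := a.2

theorem mem_maximalIdeal_restrictedRing_iff (v : Valuation E Γ₀) (a : v.restrictedRing F) :
    a ∈ IsLocalRing.maximalIdeal (v.restrictedRing F) ↔ v (v.restrictedRingHom F a) < 1 :=
  Valuation.mem_maximalIdeal_iff F (v.comap (algebraMap F E))

theorem eval₂_le_one (v : Valuation E Γ₀) {w : E} (hw : v w ≤ 1)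
    (P : (v.restrictedRing F)[X]) : v (P.eval₂ (v.restrictedRingHom F) w) ≤ 1 := by
  rw [eval₂_eq_sum, Polynomial.sum_def]
  refine v.map_sum_le fun i _ => ?_
  rw [map_mul, map_pow]
  exact mul_le_one' (v.restrictedRingHom_le_one _) (pow_le_one' hw i)

/-- A nonzero polynomial over `F` is a constant times a polynomial with integral coefficients. -/
theorem exists_eq_C_mul_map (v : Valuation E Γ₀) {P : F[X]} (hP : P ≠ 0) :
    ∃ c : F, c ≠ 0 ∧ ∃ P' : (v.restrictedRing F)[X],
      P = C c * P'.map (v.restrictedRing F).subtype := by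
  -- Dividing by a coefficient of largest value makes all coefficients integral.
  obtain ⟨i, hi, hmax⟩ := P.support.exists_max_image (fun i => v (algebraMap F E (P.coeff i)))
    (support_nonempty.mpr hP)
  have hc : P.coeff i ≠ 0 := mem_support_iff.mp hi
  have hlift : C (P.coeff i)⁻¹ * P ∈ lifts (v.restrictedRing F).subtype := by
    rw [lifts_iff_coeff_lifts]
    intro j
    refine ⟨⟨(C (P.coeff i)⁻¹ * P).coeff j, ?_⟩, rfl⟩
    rw [mem_valuationSubring_iff, comap_apply, coeff_C_mul, map_mul, map_inv₀, map_mul, map_inv₀,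
      inv_mul_le_iff₀ (by simpa [zero_lt_iff] using hc), mul_one]
    by_cases hj : P.coeff j = 0
    · simp [hj]
    · exact hmax j (mem_support_iff.mpr hj)
  obtain ⟨P', hP'⟩ := (mem_lifts _).mp hlift
  refine ⟨_, hc, P', ?_⟩
  rw [hP', ← mul_assoc, ← C_mul, mul_inv_cancel₀ hc, C_1, one_mul]

/-- If every nonunit among the values at `w` of integral polynomials is, up to a unit of the same
kind, divisible by `ϖ`, then `v ϖ` generates the value group of `F[w]`. -/
theorem exists_zpow_of_forall_dvd (v : Valuation E Γ₀) {w π ϖ : E} {e : ℕ} (hw : v w ≤ 1)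
    (hϖ0 : ϖ ≠ 0) (hϖ : v ϖ < 1) (hπ : v π = v ϖ ^ e)
    (hF : ∀ a : F, a ≠ 0 → ∃ k : ℤ, v (algebraMap F E a) = v π ^ k)
    (hdvd : ∀ P : (v.restrictedRing F)[X], v (P.eval₂ (v.restrictedRingHom F) w) < 1 →
      ∃ G R : (v.restrictedRing F)[X], v (G.eval₂ (v.restrictedRingHom F) w) = 1 ∧
        P.eval₂ (v.restrictedRingHom F) w * G.eval₂ (v.restrictedRingHom F) w =
          ϖ * R.eval₂ (v.restrictedRingHom F) w)
    (halg : IsAlgebraic F w) {y : E} (hy : y ∈ F⟮w⟯) (hy0 : y ≠ 0) :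
    ∃ k : ℤ, v y = v ϖ ^ k := by
  have hrep : ∀ z ∈ F⟮w⟯, ∃ P : F[X], aeval w P = z := by
    intro z hz
    rwa [← mem_toSubalgebra, adjoin_simple_toSubalgebra_of_isAlgebraic halg,
      Algebra.adjoin_singleton_eq_range_aeval] at hz
  -- The inverse of `y` is a polynomial in `w` too; this will bound the value of `y` from below and
  -- stop the descent.
  obtain ⟨Q, hQ⟩ := hrep _ (inv_mem hy)
  obtain ⟨P, rfl⟩ := hrep _ hy
  rename aeval w P ≠ 0 => hP
  have hv0 : v ϖ ≠ 0 := (v.ne_zero_iff).mpr hϖ0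
  have hF' : ∀ a : F, a ≠ 0 → ∃ k : ℤ, v (algebraMap F E a) = v ϖ ^ k := by
    intro a ha
    obtain ⟨k, hk⟩ := hF a ha
    exact ⟨e * k, by rw [hk, hπ, zpow_mul, zpow_natCast]⟩
  have haev : ∀ (c : F) (P' : (v.restrictedRing F)[X]),
      aeval w (C c * P'.map (v.restrictedRing F).subtype) =
        algebraMap F E c * P'.eval₂ (v.restrictedRingHom F) w := by
    intro c P'
    rw [map_mul, aeval_C, aeval_def, eval₂_map]
  -- Descent: `N` bounds how often `ϖ` can be divided out, so `v` need not be discrete on `E`.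
  have key : ∀ (N : ℕ) (P : (v.restrictedRing F)[X]),
      v ϖ ^ N ≤ v (P.eval₂ (v.restrictedRingHom F) w) →
      ∃ k : ℤ, v (P.eval₂ (v.restrictedRingHom F) w) = v ϖ ^ k := by
    intro N
    induction N with
    | zero =>
      intro P h
      exact ⟨0, by rw [zpow_zero]; exact le_antisymm (v.eval₂_le_one hw P) (by simpa using h)⟩
    | succ N ih =>
      intro P h
      rcases (v.eval₂_le_one hw P).lt_or_eq with h1 | h1
      · obtain ⟨G, R, hG, hR⟩ := hdvd P h1
        have hPR : v (P.eval₂ (v.restrictedRingHom F) w) =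
            v ϖ * v (R.eval₂ (v.restrictedRingHom F) w) := by
          rw [← map_mul, ← hR, map_mul, hG, mul_one]
        obtain ⟨k, hk⟩ := ih R (by
          rw [hPR, pow_succ'] at h
          exact le_of_mul_le_mul_left h (zero_lt_iff.mpr hv0))
        exact ⟨1 + k, by rw [hPR, hk, zpow_add₀ hv0, zpow_one]⟩
      · exact ⟨0, by rw [h1, zpow_zero]⟩
  have hP0 : P ≠ 0 := by rintro rfl; simp at hP
  obtain ⟨c, hc, P', rfl⟩ := v.exists_eq_C_mul_map hP0
  rw [haev] at hP ⊢
  obtain ⟨k, hk⟩ := hF' c hc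
  set z := P'.eval₂ (v.restrictedRingHom F) w with hz
  have hz0 : z ≠ 0 := right_ne_zero_of_mul hP
  have hQ0 : Q ≠ 0 := by rintro rfl; simp [haev, hz0, hc, ← hz] at hQ
  obtain ⟨d, hd, Q', rfl⟩ := v.exists_eq_C_mul_map hQ0
  rw [haev, haev] at hQ
  obtain ⟨l, hl⟩ := hF' d hd
  have hle : v ϖ ^ (-(k + l)) ≤ v z := by
    have : v z⁻¹ ≤ v ϖ ^ (k + l) := by
      have : z⁻¹ = algebraMap F E c * (algebraMap F E d * Q'.eval₂ (v.restrictedRingHom F) w) := by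
        rw [hQ, ← hz, mul_inv, mul_inv_cancel_left₀ (by simpa using hc)]
      rw [this, map_mul, map_mul, hk, hl, zpow_add₀ hv0, ← mul_assoc]
      exact mul_le_of_le_one_right' (v.eval₂_le_one hw Q')
    rw [zpow_neg]
    rw [map_inv₀] at this
    exact inv_le_of_inv_le₀ (zero_lt_iff.mpr (v.ne_zero_iff.mpr hz0)) this
  obtain ⟨k', hk'⟩ := key (-(k + l)).toNat P' (by
    refine le_trans ?_ hle
    rw [← zpow_natCast]
    exact zpow_le_zpow_right_of_le_one₀ (zero_lt_iff.mpr hv0) hϖ.le (Int.self_le_toNat _))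
  exact ⟨k + k', by rw [map_mul, hk, hk', zpow_add₀ hv0]⟩

/-- If `v π < 1` generates the value group of `F`, then nonunits of `F` are multiples of `π`. -/
theorem exists_eq_mul_of_lt_one (v : Valuation E Γ₀) {p : F} (hp0 : p ≠ 0)
    (hp : v (algebraMap F E p) < 1)
    (hF : ∀ a : F, a ≠ 0 → ∃ k : ℤ, v (algebraMap F E a) = v (algebraMap F E p) ^ k)
    (a : v.restrictedRing F) (ha : v (v.restrictedRingHom F a) < 1) :
    ∃ b : v.restrictedRing F, (a : F) = p * b := by
  have hv0 : v (algebraMap F E p) ≠ 0 := by simpa using hp0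
  refine ⟨⟨p⁻¹ * a, ?_⟩, by rw [mul_inv_cancel_left₀ hp0]⟩
  rw [mem_valuationSubring_iff, comap_apply, map_mul, map_inv₀, map_mul, map_inv₀,
    inv_mul_le_iff₀ (zero_lt_iff.mpr hv0), mul_one]
  by_cases ha0 : (a : F) = 0
  · simp [ha0]
  obtain ⟨k, hk⟩ := hF a ha0
  change v (algebraMap F E a) < 1 at ha
  rw [hk] at ha ⊢
  have hk1 : 1 ≤ k := by
    by_contra! h
    refine ha.not_ge (one_le_zpow_of_nonpos₀ (zero_lt_iff.mpr hv0) hp.le (by omega))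
  simpa using zpow_le_zpow_right_of_le_one₀ (zero_lt_iff.mpr hv0) hp.le hk1

/-- Eisenstein case: if `P(w)` is a nonunit, so is its constant coefficient, which is then a
multiple of `p`, hence of `w ^ m`. So `w` divides `P(w)`. -/
theorem exists_zpow_of_ramified (v : Valuation E Γ₀) {p : F} {w : E} {m : ℕ} (hm : m ≠ 0)
    (hp0 : p ≠ 0) (hp : v (algebraMap F E p) < 1)
    (hF : ∀ a : F, a ≠ 0 → ∃ k : ℤ, v (algebraMap F E a) = v (algebraMap F E p) ^ k)
    {u : F} (hu : w ^ m = algebraMap F E u) (hw : v w ^ m = v (algebraMap F E p))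
    {y : E} (hy : y ∈ F⟮w⟯) (hy0 : y ≠ 0) : ∃ k : ℤ, v y = v w ^ k := by
  have halg : IsAlgebraic F w := by
    refine IsAlgebraic.of_pow (Nat.pos_of_ne_zero hm) ?_
    rw [hu]
    exact isAlgebraic_algebraMap u
  have hv0 : v (algebraMap F E p) ≠ 0 := by simpa using hp0
  have hw0 : w ≠ 0 := by
    rintro rfl
    rw [map_zero, zero_pow hm] at hw
    exact hv0 hw.symm
  have hw1 : v w < 1 := (pow_lt_one_iff hm).mp (hw ▸ hp)
  have hu0 : u ≠ 0 := by
    rintro rfl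
    exact pow_ne_zero m hw0 (by simpa using hu)
  refine v.exists_zpow_of_forall_dvd hw1.le hw0 hw1 hw.symm hF (fun P hP => ?_) halg hy hy0
  have hPe : P.eval₂ (v.restrictedRingHom F) w =
      w * P.divX.eval₂ (v.restrictedRingHom F) w + v.restrictedRingHom F (P.coeff 0) := by
    conv_lhs => rw [← P.divX_mul_X_add]
    rw [eval₂_add, eval₂_mul_X, eval₂_C, mul_comm]
  have hP0 : v (v.restrictedRingHom F (P.coeff 0)) < 1 := by
    have : v.restrictedRingHom F (P.coeff 0) = P.eval₂ (v.restrictedRingHom F) w -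
        w * P.divX.eval₂ (v.restrictedRingHom F) w := by rw [hPe]; ring
    rw [this]
    refine v.map_sub_lt hP ?_
    rw [map_mul]
    exact mul_lt_one_of_lt_of_le hw1 (v.eval₂_le_one hw1.le _)
  obtain ⟨b, hb⟩ := v.exists_eq_mul_of_lt_one hp0 hp hF _ hP0
  -- `u = w ^ m` has the value of `p`, so `p` is an integral multiple of `w ^ m`.
  have hunit : p / u ∈ v.restrictedRing F := by
    rw [mem_valuationSubring_iff, comap_apply, map_div₀, map_div₀, ← hu, map_pow, hw,
      div_self hv0]
  refine ⟨1, P.divX + C (⟨p / u, hunit⟩ * b) * X ^ (m - 1), by simp, ?_⟩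
  have hcoef : v.restrictedRingHom F (P.coeff 0) =
      w * (v.restrictedRingHom F (⟨p / u, hunit⟩ * b) * w ^ (m - 1)) := by
    rw [mul_left_comm, mul_pow_sub_one hm, hu]
    change algebraMap F E (P.coeff 0 : F) = algebraMap F E (p / u * b) * _
    rw [hb, ← map_mul]
    congr 1
    field_simp
  rw [hPe, eval₂_one, mul_one, eval₂_add, eval₂_mul, eval₂_C, eval₂_X_pow, hcoef]
  ring

/-- `X ^ m - u` stays separable over the residue field, because `m` and `u` are units. Factoring the
reduction through a gcd replaces Hensel's lemma, and `X ^ m - u` need not be irreducible. -/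
theorem exists_zpow_of_unramified (v : Valuation E Γ₀) {p : F} {w : E} {m : ℕ} (hm0 : m ≠ 0)
    (hm : v (m : E) = 1)
    (hp0 : p ≠ 0) (hp : v (algebraMap F E p) < 1)
    (hF : ∀ a : F, a ≠ 0 → ∃ k : ℤ, v (algebraMap F E a) = v (algebraMap F E p) ^ k)
    {u : F} (hu : w ^ m = algebraMap F E u) (hw : v w = 1)
    {y : E} (hy : y ∈ F⟮w⟯) (hy0 : y ≠ 0) :
    ∃ k : ℤ, v y = v (algebraMap F E p) ^ k := by
  have halg : IsAlgebraic F w := by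
    refine IsAlgebraic.of_pow (Nat.pos_of_ne_zero hm0) ?_
    rw [hu]
    exact isAlgebraic_algebraMap u
  have hp0' : algebraMap F E p ≠ 0 := by simpa using hp0
  have hvu : v (algebraMap F E u) = 1 := by rw [← hu, map_pow, hw, one_pow]
  let U : v.restrictedRing F := ⟨u, hvu.le⟩
  let ρ := IsLocalRing.residue (v.restrictedRing F)
  have hρ : ∀ a : v.restrictedRing F, ρ a = 0 ↔ v (v.restrictedRingHom F a) < 1 := fun a => by
    rw [← mem_maximalIdeal_restrictedRing_iff, IsLocalRing.residue_eq_zero_iff]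
  -- polynomials with zero reduction are multiples of the uniformizer
  have hker : ∀ A : (v.restrictedRing F)[X], A.map ρ = 0 → ∃ B : (v.restrictedRing F)[X],
      A.eval₂ (v.restrictedRingHom F) w =
        algebraMap F E p * B.eval₂ (v.restrictedRingHom F) w := by
    intro A hA
    have hA' : C p⁻¹ * A.map (v.restrictedRing F).subtype ∈ lifts (v.restrictedRing F).subtype := by
      rw [lifts_iff_coeff_lifts]
      intro j
      have hj : ρ (A.coeff j) = 0 := by rw [← coeff_map, hA, coeff_zero]
      obtain ⟨b, hb⟩ := v.exists_eq_mul_of_lt_one hp0 hp hF _ ((hρ _).mp hj)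
      refine ⟨b, ?_⟩
      rw [coeff_C_mul, coeff_map]
      change (b : F) = p⁻¹ * (A.coeff j : F)
      rw [hb, inv_mul_cancel_left₀ hp0]
    obtain ⟨B, hB⟩ := (mem_lifts _).mp hA'
    refine ⟨B, ?_⟩
    rw [← eval₂_map, ← eval₂_map, hB, eval₂_mul, eval₂_C, map_inv₀, mul_inv_cancel_left₀ hp0']
  let f : (v.restrictedRing F)[X] := X ^ m - C U
  have hf : f.eval₂ (v.restrictedRingHom F) w = 0 := by
    simp only [f, eval₂_sub, eval₂_X_pow, eval₂_C]
    exact sub_eq_zero.mpr hu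
  have hsep : (f.map ρ).Separable := by
    have : f.map ρ = X ^ m - C (ρ U) := by simp [f]
    rw [this]
    refine separable_X_pow_sub_C _ ?_ ?_
    · rw [← map_natCast ρ, Ne, hρ, map_natCast, hm]
      exact lt_irrefl _
    · rw [Ne, hρ]
      exact hvu.not_lt
  refine v.exists_zpow_of_forall_dvd (e := 1) hw.le hp0' hp (pow_one _).symm hF
    (fun P hP => ?_) halg hy hy0
  classical
  -- With `D` the gcd of the reductions of `P` and `f`, write these as `D * H'` and `D * G'`. Then
  -- `P * G` reduces to `f * H`, and `f` vanishes at `w`, so `p` divides `P(w) * G(w)`.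
  obtain ⟨G', hG'⟩ := EuclideanDomain.gcd_dvd_right (P.map ρ) (f.map ρ)
  obtain ⟨H', hH'⟩ := EuclideanDomain.gcd_dvd_left (P.map ρ) (f.map ρ)
  have hgcd := EuclideanDomain.gcd_eq_gcd_ab (P.map ρ) (f.map ρ)
  set D := EuclideanDomain.gcd (P.map ρ) (f.map ρ) with hD
  obtain ⟨a, b, hab⟩ : IsCoprime D G' := by
    rw [hG'] at hsep
    exact hsep.isCoprime
  have hsurj := map_surjective ρ IsLocalRing.residue_surjective
  obtain ⟨G, rfl⟩ := hsurj G'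
  obtain ⟨H, rfl⟩ := hsurj H'
  obtain ⟨c, hc⟩ := hsurj (a * EuclideanDomain.gcdA (P.map ρ) (f.map ρ))
  obtain ⟨d, hd⟩ := hsurj (a * EuclideanDomain.gcdB (P.map ρ) (f.map ρ))
  obtain ⟨b', rfl⟩ := hsurj b
  obtain ⟨R, hR⟩ := hker (P * G - f * H) (by
    rw [Polynomial.map_sub, Polynomial.map_mul, Polynomial.map_mul]
    linear_combination (G.map ρ) * hH' - (H.map ρ) * hG')
  obtain ⟨S, hS⟩ := hker (c * P + d * f + b' * G - 1) (by
    simp only [Polynomial.map_sub, Polynomial.map_add, Polynomial.map_mul, Polynomial.map_one,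
      hc, hd]
    linear_combination hab - a * hgcd)
  refine ⟨G, R, ?_, ?_⟩
  -- Separability makes `D` and `G'` coprime, so `1` is a combination of `P(w)` and `G(w)` modulo
  -- `p`. Since `P(w)` is a nonunit, `G(w)` is a unit.
  · simp only [eval₂_sub, eval₂_add, eval₂_mul, eval₂_one, hf, mul_zero, add_zero] at hS
    by_contra hne
    have hlt := lt_of_le_of_ne (v.eval₂_le_one hw.le G) hne
    have h1 : (1 : E) = c.eval₂ (v.restrictedRingHom F) w * P.eval₂ (v.restrictedRingHom F) w +
        b'.eval₂ (v.restrictedRingHom F) w * G.eval₂ (v.restrictedRingHom F) w -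
        algebraMap F E p * S.eval₂ (v.restrictedRingHom F) w := by
      rw [← hS]; ring
    have : v (1 : E) < 1 := by
      rw [h1]
      refine v.map_sub_lt (v.map_add_lt ?_ ?_) ?_ <;> rw [map_mul]
      · exact mul_comm (v _) _ ▸ mul_lt_one_of_lt_of_le hP (v.eval₂_le_one hw.le _)
      · exact mul_comm (v _) _ ▸ mul_lt_one_of_lt_of_le hlt (v.eval₂_le_one hw.le _)
      · exact mul_lt_one_of_lt_of_le hp (v.eval₂_le_one hw.le _)
    rw [map_one] at this
    exact lt_irrefl _ this
  · simpa only [eval₂_sub, eval₂_mul, hf, zero_mul, sub_zero] using hR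

/-- The value group of `K(x)` at a place trivial on `K` where `x` has positive order. -/
theorem exists_zpow_of_trivial_on {K : Type*} [Field K] [Algebra K E] (v : Valuation E Γ₀)
    (hK : ∀ c : K, v (algebraMap K E c) ≤ 1) {b : E} (hb : v b < 1)
    (P : K[X]) (hP : aeval b P ≠ 0) : ∃ k : ℤ, v (aeval b P) = v b ^ k := by
  have hP0 : P ≠ 0 := by rintro rfl; simp at hP
  have hK1 : ∀ c : K, c ≠ 0 → v (algebraMap K E c) = 1 := by
    intro c hc
    refine le_antisymm (hK c) ?_
    have := hK c⁻¹
    rwa [map_inv₀, map_inv₀, inv_le_one₀ (by simpa [zero_lt_iff] using hc)] at this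
  have hint : ∀ P : K[X], v (aeval b P) ≤ 1 := by
    intro P
    rw [aeval_def, eval₂_eq_sum, Polynomial.sum_def]
    refine v.map_sum_le fun i _ => ?_
    rw [map_mul, map_pow]
    exact mul_le_one' (hK _) (pow_le_one' hb.le i)
  -- Split off the power of `X`; the cofactor has nonzero constant term, hence value 1 at `b`.
  obtain ⟨G, hPG, hG⟩ := P.exists_eq_pow_rootMultiplicity_mul_and_not_dvd hP0 0
  rw [C_0, sub_zero] at hPG hG
  refine ⟨(P.rootMultiplicity 0 : ℕ), ?_⟩
  rw [zpow_natCast]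
  conv_lhs => rw [hPG]
  rw [map_mul, map_pow, aeval_X, map_mul, map_pow]
  suffices v (aeval b G) = 1 by rw [this, mul_one]
  have hG0 : G.coeff 0 ≠ 0 := by rwa [Ne, ← X_dvd_iff]
  conv_lhs => rw [← G.divX_mul_X_add]
  rw [map_add, map_mul, aeval_X, aeval_C, v.map_add_eq_of_lt_right, hK1 _ hG0]
  rw [hK1 _ hG0, map_mul, mul_comm]
  exact mul_lt_one_of_lt_of_le hb (hint _)

end Valuation

/-! ### Residues and orders of the generators at a zero of `x T - α`. -/

namespace KummerTower

open Polynomial IntermediateField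

variable {K E Γ₀ : Type*} [Field K] [Field E] [Algebra K E] [LinearOrderedCommGroupWithZero Γ₀]

theorem valuation_algebraMap_eq_one {v : Valuation E Γ₀}
    (hv : ∀ c : K, v (algebraMap K E c) ≤ 1) {c : K} (hc : c ≠ 0) :
    v (algebraMap K E c) = 1 := by
  refine le_antisymm (hv c) ?_
  have := hv c⁻¹
  rwa [map_inv₀, map_inv₀, inv_le_one₀ (by simpa [zero_lt_iff] using hc)] at this

/-- Near a nonzero element `β` of `𝔽_q`, the function `1 - y ^ (q - 1)` has a simple zero. -/
theorem valuation_one_sub_pow [Finite K] (hK : 2 < Nat.card K) {v : Valuation E Γ₀}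
    (hv : ∀ c : K, v (algebraMap K E c) ≤ 1) {β : K} (hβ : β ≠ 0) {y : E}
    (hy : v (y - algebraMap K E β) < 1) :
    v (1 - y ^ (Nat.card K - 1)) = v (y - algebraMap K E β) := by
  have := Fintype.ofFinite K
  have hy1 : v y = 1 := by
    rw [← sub_add_cancel y (algebraMap K E β), v.map_add_eq_of_lt_right,
      valuation_algebraMap_eq_one hv hβ]
    rwa [valuation_algebraMap_eq_one hv hβ]
  have hfrob : (y - algebraMap K E β) ^ Nat.card K = y ^ Nat.card K - algebraMap K E β := by
    have h := map_sub (FiniteField.frobeniusAlgHom K E) y (algebraMap K E β)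
    rw [AlgHom.commutes] at h
    simpa [Nat.card_eq_fintype_card] using h
  set δ := y - algebraMap K E β with hδ
  have hq : Nat.card K - 1 + 1 = Nat.card K := by omega
  -- This is `y - y ^ q = δ - δ ^ q`, valid because `β ^ q = β`.
  have h : y * (1 - y ^ (Nat.card K - 1)) = δ * (1 - δ ^ (Nat.card K - 1)) := by
    have h1 : y * (1 - y ^ (Nat.card K - 1)) = y - y ^ (Nat.card K - 1 + 1) := by ring
    have h2 : δ * (1 - δ ^ (Nat.card K - 1)) = δ - δ ^ (Nat.card K - 1 + 1) := by ring
    rw [h1, h2, hq, hfrob, hδ]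
    ring
  have h3 : v (1 - δ ^ (Nat.card K - 1)) = 1 := by
    refine v.map_one_sub_of_lt ?_
    rw [map_pow]
    exact pow_lt_one₀ zero_le hy (by omega)
  simpa only [map_mul, hy1, one_mul, h3, mul_one] using congrArg v h

/-- The residue class of `x j` at a place that is a zero of `x T - α`. -/
def residueAt (T : ℕ) (α : K) (j : ℕ) : K :=
  if j < T then -1 else if j = T then α else 0

theorem residueAt_ne_neg_one {T : ℕ} {α : K} (hα : α ≠ -1) {j : ℕ} (hj : T ≤ j) :
    residueAt T α j ≠ -1 := by
  unfold residueAt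
  split_ifs
  · omega
  · exact hα
  · exact (neg_ne_zero.mpr one_ne_zero).symm

theorem residueAt_ne_zero {T : ℕ} {α : K} (hα : α ≠ 0) {j : ℕ} (hj : j ≤ T) :
    residueAt T α j ≠ 0 := by
  unfold residueAt
  split_ifs
  · exact neg_ne_zero.mpr one_ne_zero
  · exact hα
  · omega

/-- The function `x j` minus its residue class at a place that is a zero of `x T - α`. -/
def centered (x : ℕ → E) (T : ℕ) (α : K) (j : ℕ) : E :=
  x j - algebraMap K E (residueAt T α j)

theorem centered_of_lt (x : ℕ → E) {T : ℕ} (α : K) {j : ℕ} (hj : T < j) :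
    centered x T α j = x j := by
  rw [centered, residueAt, if_neg (by omega), if_neg (by omega), map_zero, sub_zero]

theorem centered_self (x : ℕ → E) (T : ℕ) (α : K) :
    centered x T α T = x T - algebraMap K E α := by
  rw [centered, residueAt, if_neg (lt_irrefl T), if_pos rfl]

/-- A valuation of the tower that is trivial on `𝔽_q` and a zero of `x T - α`,
with `α ≠ 0, -1`. -/
structure IsZeroAt (K : Type*) {E Γ₀ : Type*} [Field K] [Field E] [Algebra K E]
    [LinearOrderedCommGroupWithZero Γ₀] (x : ℕ → E) (v : Valuation E Γ₀) (T : ℕ) (α : K) :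
    Prop where
  generating : IsGeneratingSequence K x
  card : 2 < Nat.card K
  le_one : ∀ c : K, v (algebraMap K E c) ≤ 1
  ne_zero : α ≠ 0
  ne_neg_one : α ≠ -1
  lt_one : v (x T - algebraMap K E α) < 1

namespace IsZeroAt

variable {x : ℕ → E} {v : Valuation E Γ₀} {T : ℕ} {α : K}

theorem finite (h : IsZeroAt K x v T α) : Finite K :=
  Nat.finite_of_card_ne_zero (by have := h.card; omega)

theorem card_sub_one_ne_zero (h : IsZeroAt K x v T α) : Nat.card K - 1 ≠ 0 := by
  have := h.card
  omega

theorem pow_centered_of_lt (h : IsZeroAt K x v T α) {j : ℕ} (hj : j < T)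
    (hlt : v (centered x T α (j + 1)) < 1) :
    v (centered x T α j) ^ (Nat.card K - 1) = v (centered x T α (j + 1)) := by
  have := h.finite
  rw [← map_pow]
  conv_rhs => rw [centered, ← valuation_one_sub_pow h.card h.le_one
    (residueAt_ne_zero h.ne_zero hj) hlt]
  rw [centered, residueAt, if_pos hj, map_neg, map_one, sub_neg_eq_add,
    eq_sub_of_add_eq' (h.generating.relation j)]

theorem pow_centered_of_le (h : IsZeroAt K x v T α) {j : ℕ} (hj : T ≤ j)
    (hlt : v (centered x T α j) < 1) :
    v (centered x T α (j + 1)) ^ (Nat.card K - 1) = v (centered x T α j) := by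
  have := h.finite
  have hβ : residueAt T α j + 1 ≠ 0 := fun h0 =>
    residueAt_ne_neg_one h.ne_neg_one hj (eq_neg_of_add_eq_zero_left h0)
  have hc : x j + 1 - algebraMap K E (residueAt T α j + 1) = centered x T α j := by
    rw [map_add, map_one, centered]
    ring
  rw [← map_pow, ← hc, ← valuation_one_sub_pow h.card h.le_one hβ (hc ▸ hlt),
    centered_of_lt x α (Nat.lt_succ_of_le hj), eq_sub_of_add_eq (h.generating.relation j)]

/-- Smallness spreads from `T` both ways: on either side, the `(q - 1)`-th power of the next value
is the one already known to be below 1. -/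
theorem centered_lt_one (h : IsZeroAt K x v T α) (j : ℕ) : v (centered x T α j) < 1 := by
  have hm := h.card_sub_one_ne_zero
  rcases le_total j T with hj | hj
  · induction hj using Nat.decreasingInduction with
    | self => rw [centered_self]; exact h.lt_one
    | of_succ j hj ih =>
      exact (pow_lt_one_iff hm).mp (h.pow_centered_of_lt hj ih ▸ ih)
  · induction j, hj using Nat.le_induction with
    | base => rw [centered_self]; exact h.lt_one
    | succ j hj ih => exact (pow_lt_one_iff hm).mp (h.pow_centered_of_le hj ih ▸ ih)

theorem centered_zero_ne_zero (h : IsZeroAt K x v T α) : centered x T α 0 ≠ 0 := by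
  intro h0
  rw [centered, sub_eq_zero] at h0
  exact h.generating.transcendental (h0 ▸ isAlgebraic_algebraMap _)

theorem valuation_centered_eq_pow (h : IsZeroAt K x v T α) {j : ℕ} (hj : j ≤ T) :
    v (centered x T α j) = v (centered x T α 0) ^ (Nat.card K - 1) ^ j := by
  induction j with
  | zero => rw [pow_zero, pow_one]
  | succ j ih =>
    rw [← h.pow_centered_of_lt hj (h.centered_lt_one _), ih (by omega), ← pow_mul, ← pow_succ]

theorem valuation_centered_add_eq_pow (h : IsZeroAt K x v T α) {j : ℕ} (hj : j ≤ T) :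
    v (centered x T α (T + j)) = v (centered x T α 0) ^ (Nat.card K - 1) ^ (T - j) := by
  induction j with
  | zero => exact h.valuation_centered_eq_pow le_rfl
  | succ j ih =>
    refine pow_left_injective h.card_sub_one_ne_zero ?_
    change v (centered x T α (T + j + 1)) ^ _ = _ ^ _
    rw [h.pow_centered_of_le (by omega) (h.centered_lt_one _), ih (by omega), ← pow_mul,
      ← pow_succ]
    congr 2
    omega

/-- Supplies the power of `b` that turns `x (i + 1)` into a unit. For `i < T` the residue of `x (i +
1)` is nonzero and `M = 0` works. -/
theorem exists_valuation_eq_pow (h : IsZeroAt K x v T α) {i : ℕ} (hi : i < 2 * T) :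
    ∃ M : ℕ, v (x (i + 1)) = v (centered x T α 0) ^ M := by
  by_cases hT : i < T
  · refine ⟨0, ?_⟩
    have h1 := valuation_algebraMap_eq_one h.le_one (residueAt_ne_zero h.ne_zero hT)
    rw [pow_zero, ← sub_add_cancel (x (i + 1)) (algebraMap K E (residueAt T α (i + 1))),
      v.map_add_eq_of_lt_right, h1]
    rw [h1]
    exact h.centered_lt_one (i + 1)
  · refine ⟨(Nat.card K - 1) ^ (T - (i + 1 - T)), ?_⟩
    rw [← centered_of_lt x α (show T < i + 1 by omega), ← h.valuation_centered_add_eq_pow (by omega), Nat.add_sub_cancel' (by omega)]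

end IsZeroAt

/-! ### Induction along the tower: generators of the value groups. -/

theorem gen_mem (K : Type*) {E : Type*} [Field K] [Field E] [Algebra K E] (x : ℕ → E) {n i : ℕ}
    (h : i ≤ n) : x i ∈ level K x n :=
  (gen K x h).2

theorem centered_mem (x : ℕ → E) (T : ℕ) (α : K) {n j : ℕ} (h : j ≤ n) :
    centered x T α j ∈ level K x n :=
  sub_mem (gen_mem K x h) (_root_.algebraMap_mem _ _)

theorem level_succ_eq (x : ℕ → E) (n : ℕ) :
    level K x (n + 1) = restrictScalars K ((level K x n)⟮x (n + 1)⟯) := by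
  rw [level, level, adjoin_adjoin_left, ← Set.image_singleton, ← Set.image_union]
  congr 2
  ext i
  simp
  omega

theorem IsGeneratingSequence.pow_mem {x : ℕ → E} (hx : IsGeneratingSequence K x) (n : ℕ) :
    x (n + 1) ^ (Nat.card K - 1) ∈ level K x n := by
  rw [eq_sub_of_add_eq (hx.relation n)]
  exact sub_mem (one_mem _) (_root_.pow_mem (add_mem (gen_mem K x le_rfl) (one_mem _)) _)

namespace IsZeroAt

variable {x : ℕ → E} {v : Valuation E Γ₀} {T : ℕ} {α : K}

theorem exists_zpow_level_zero (h : IsZeroAt K x v T α) {z : E} (hz : z ∈ level K x 0)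
    (hz0 : z ≠ 0) : ∃ k : ℤ, v z = v (centered x T α 0) ^ k := by
  have hz' : z ∈ K⟮centered x T α 0⟯ := by
    refine (adjoin_le_iff.mpr ?_ : level K x 0 ≤ _) hz
    rintro _ ⟨i, hi, rfl⟩
    obtain rfl : i = 0 := by simpa using hi
    rw [← sub_add_cancel (x 0) (algebraMap K E (residueAt T α 0))]
    exact add_mem (mem_adjoin_simple_self K _) (_root_.algebraMap_mem _ _)
  obtain ⟨r, s, rfl⟩ := (mem_adjoin_simple_iff K z).mp hz'
  obtain ⟨hr, hs⟩ := div_ne_zero_iff.mp hz0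
  obtain ⟨k, hk⟩ := v.exists_zpow_of_trivial_on h.le_one (h.centered_lt_one 0) r hr
  obtain ⟨l, hl⟩ := v.exists_zpow_of_trivial_on h.le_one (h.centered_lt_one 0) s hs
  refine ⟨k - l, ?_⟩
  rw [map_div₀, hk, hl, zpow_sub₀ (by simpa using h.centered_zero_ne_zero)]

theorem exists_zpow_of_le (h : IsZeroAt K x v T α) {i : ℕ} (hi : i ≤ 2 * T) {z : E}
    (hz : z ∈ level K x i) (hz0 : z ≠ 0) : ∃ k : ℤ, v z = v (centered x T α 0) ^ k := by
  induction i generalizing z with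
  | zero => exact h.exists_zpow_level_zero hz hz0
  | succ i ih =>
    obtain ⟨M, hM⟩ := h.exists_valuation_eq_pow hi
    have hb0 := h.centered_zero_ne_zero
    have := h.finite
    have := Fintype.ofFinite K
    let p : level K x i := ⟨centered x T α 0, centered_mem x T α (Nat.zero_le i)⟩
    let u : level K x i := ⟨x (i + 1) ^ (Nat.card K - 1), h.generating.pow_mem i⟩ /
      (p ^ M) ^ (Nat.card K - 1)
    -- In `E` the integer `q - 1` equals `-1`.
    have hm : v ((Nat.card K - 1 : ℕ) : E) = 1 := by
      have hq : (Nat.card K : E) = 0 := by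
        have := congrArg (algebraMap K E) (FiniteField.cast_card_eq_zero K)
        rwa [map_natCast, map_zero, ← Nat.card_eq_fintype_card] at this
      rw [Nat.cast_sub (by have := h.card; omega), hq, Nat.cast_one, zero_sub, v.map_neg, map_one]
    refine v.exists_zpow_of_unramified (F := level K x i) (p := p)
      (w := x (i + 1) / centered x T α 0 ^ M) (u := u) h.card_sub_one_ne_zero hm
      (fun h0 => hb0 (congrArg Subtype.val h0)) (h.centered_lt_one 0)
      (fun a ha => ih (by omega) a.2 (by simpa using ha)) ?_ ?_ ?_ hz0
    · rw [div_pow]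
      rfl
    · rw [map_div₀, map_pow, hM, div_self]
      exact pow_ne_zero _ (by simpa using hb0)
    · rw [level_succ_eq] at hz
      refine (adjoin_simple_le_iff.mpr ?_ : (level K x i)⟮x (i + 1)⟯ ≤ _) hz
      have hmem := mul_mem (mem_adjoin_simple_self (level K x i) (x (i + 1) / centered x T α 0 ^ M))
        (_root_.algebraMap_mem _ (p ^ M))
      rwa [show algebraMap (level K x i) E (p ^ M) = centered x T α 0 ^ M from rfl,
        div_mul_cancel₀ _ (pow_ne_zero M hb0)] at hmem

theorem centered_ne_zero_of_ge (h : IsZeroAt K x v T α) {i : ℕ} (hi : T ≤ i) :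
    centered x T α i ≠ 0 := by
  have hm := h.card_sub_one_ne_zero
  induction i, hi using Nat.le_induction with
  | base =>
    rw [← v.ne_zero_iff, h.valuation_centered_eq_pow le_rfl]
    exact pow_ne_zero _ (v.ne_zero_iff.mpr h.centered_zero_ne_zero)
  | succ i hi ih =>
    rw [← v.ne_zero_iff, ← pow_ne_zero_iff hm, h.pow_centered_of_le hi (h.centered_lt_one i)]
    exact v.ne_zero_iff.mpr ih

theorem exists_zpow_of_ge (h : IsZeroAt K x v T α) {i : ℕ} (hi : 2 * T ≤ i) {z : E}
    (hz : z ∈ level K x i) (hz0 : z ≠ 0) : ∃ k : ℤ, v z = v (centered x T α i) ^ k := by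
  induction i, hi using Nat.le_induction generalizing z with
  | base =>
    -- At index `2T` the exponent `(q - 1) ^ (T - T)` is 1, so the uniformizer can be switched from
    -- `b` to the last generator, centered.
    have := h.valuation_centered_add_eq_pow le_rfl
    rw [← two_mul, Nat.sub_self, pow_zero, pow_one] at this
    rw [this]
    exact h.exists_zpow_of_le le_rfl hz hz0
  | succ i hi ih =>
    have hpow := h.pow_centered_of_le (show T ≤ i by omega) (h.centered_lt_one i)
    have hb0 := h.centered_ne_zero_of_ge (show T ≤ i by omega)
    rw [level_succ_eq] at hz
    rw [centered_of_lt x α (show T < i + 1 by omega)] at hpow ⊢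
    exact v.exists_zpow_of_ramified (F := level K x i)
      (p := ⟨centered x T α i, centered_mem x T α le_rfl⟩)
      (u := ⟨x (i + 1) ^ (Nat.card K - 1), h.generating.pow_mem i⟩) h.card_sub_one_ne_zero
      (fun h0 => hb0 (congrArg Subtype.val h0)) (h.centered_lt_one i)
      (fun a ha => ih a.2 (by simpa using ha)) rfl hpow hz hz0

end IsZeroAt

end KummerTower

/-! ### Extension of places and computation of the ramification index. -/

namespace Place

variable {K F F' : Type*} [Field K] [Field F] [Field F'] [Algebra K F] [Algebra K F']

/-- Extension of places to an extension field. -/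
theorem exists_comap_eq {F F' : Type*} [Field F] [Field F'] (A : ValuationSubring F)
    (f : F →+* F') : ∃ B : ValuationSubring F', B.comap f = A := by
  -- `B` dominates `A`: if `z` lies in `B` but not in `A`, then `z⁻¹` is in `A` and a unit of `B`,
  -- hence a unit of `A`, a contradiction.
  obtain ⟨B, hB, hloc⟩ := IsLocalRing.exists_factor_valuationRing (f.comp A.subtype)
  refine ⟨B, SetLike.ext fun z => ⟨fun hz => ?_, fun hz => hB ⟨z, hz⟩⟩⟩
  by_contra hzA
  have hz0 : z ≠ 0 := by rintro rfl; exact hzA (zero_mem A)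
  have hinv : z⁻¹ ∈ A := (A.mem_or_inv_mem z).resolve_left hzA
  have hunit : IsUnit (((f.comp A.subtype).codRestrict B.toSubring hB) ⟨z⁻¹, hinv⟩) := by
    refine IsUnit.of_mul_eq_one ⟨f z, hz⟩ (Subtype.ext ?_)
    change f z⁻¹ * f z = 1
    rw [← map_mul, inv_mul_cancel₀ hz0, map_one]
  obtain ⟨c, hc⟩ := isUnit_iff_exists_inv.mp (hloc.map_nonunit _ hunit)
  have hcz : (c : F) = z := by
    have := congrArg Subtype.val hc
    change z⁻¹ * (c : F) = 1 at this
    rwa [inv_mul_eq_one₀ hz0, eq_comm] at this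
  exact hzA (hcz ▸ c.2)

theorem exists_liesOver (f : F →ₐ[K] F') (Q : Place K F) : ∃ Q' : Place K F', LiesOver f Q' Q := by
  obtain ⟨B, hB⟩ := exists_comap_eq Q.ring (f : F →+* F')
  refine ⟨⟨B, fun c => ?_, ?_⟩, hB⟩
  · have := Q.algebraMap_mem c
    rw [← hB, ValuationSubring.mem_comap] at this
    simpa using this
  · rintro rfl
    refine Q.ne_top (hB ▸ ?_)
    ext z
    simp [ValuationSubring.mem_comap]

theorem ramificationIndex_eq (f : F →ₐ[K] F') (Q' : Place K F') {ϖ : F'} {a : F} {e : ℕ}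
    (hϖ0 : ϖ ≠ 0) (hϖ : Q'.ring.valuation ϖ < 1)
    (hgen : ∀ z : F', z ≠ 0 → ∃ k : ℤ, Q'.ring.valuation z = Q'.ring.valuation ϖ ^ k)
    (ha0 : a ≠ 0) (ha : Q'.ring.valuation (f a) = Q'.ring.valuation ϖ ^ e)
    (hF : ∀ c : F, c ≠ 0 → ∃ k : ℤ, Q'.ring.valuation (f c) = Q'.ring.valuation (f a) ^ k) :
    ramificationIndex f Q' = e := by
  have hv0 : Q'.ring.valuation ϖ ≠ 0 := by simpa using hϖ0
  -- Pulling back along `k ↦ v(ϖ) ^ k` turns the image of the units of `F` into the subgroup `eℤ` of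
  -- `ℤ`.
  let φ := zpowersHom (Q'.ring.ValueGroup)ˣ (Units.mk0 _ hv0)
  have hφ : ∀ n : ℤ, ((φ (Multiplicative.ofAdd n) : (Q'.ring.ValueGroup)ˣ) : Q'.ring.ValueGroup) =
      Q'.ring.valuation ϖ ^ n := fun n => by
    simp [φ]
  have hsurj : Function.Surjective φ := by
    intro y
    obtain ⟨z, hz⟩ := Q'.ring.valuation_surjective y
    obtain ⟨k, hk⟩ := hgen z (by rintro rfl; exact y.ne_zero (by rw [← hz, map_zero]))
    exact ⟨Multiplicative.ofAdd k, Units.ext (by rw [hφ, ← hk, hz])⟩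
  rw [ramificationIndex, ← Subgroup.index_comap_of_surjective _ hsurj]
  have hcomap : Subgroup.comap φ ((Units.map (Q'.ring.valuation : F' →* Q'.ring.ValueGroup)).comp
      (Units.map (f : F →* F'))).range =
      AddSubgroup.toSubgroup (AddSubgroup.zmultiples (e : ℤ)) := by
    ext n
    obtain ⟨n, rfl⟩ := Multiplicative.ofAdd.surjective n
    have hmem : Multiplicative.ofAdd n ∈ AddSubgroup.toSubgroup (AddSubgroup.zmultiples (e : ℤ)) ↔
        (e : ℤ) ∣ n := Int.mem_zmultiples_iff
    rw [hmem, Subgroup.mem_comap, MonoidHom.mem_range]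
    constructor
    · rintro ⟨c, hc⟩
      have hc' := congrArg Units.val hc
      rw [hφ] at hc'
      change Q'.ring.valuation (f c) = _ at hc'
      obtain ⟨k, hk⟩ := hF c c.ne_zero
      rw [hk, ha, ← zpow_natCast, ← zpow_mul] at hc'
      exact ⟨k, (zpow_right_injective₀ (zero_lt_iff.mpr hv0) hϖ.ne hc').symm⟩
    · rintro ⟨k, rfl⟩
      refine ⟨Units.mk0 a ha0 ^ k, Units.ext ?_⟩
      rw [hφ, map_zpow, Units.val_zpow_eq_zpow_val]
      change Q'.ring.valuation (f a) ^ k = _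
      rw [ha, zpow_mul, zpow_natCast]
  rw [hcomap, AddSubgroup.index_toSubgroup, Int.index_zmultiples, Int.natAbs_natCast]

end Place

/-! ### The ramification index at each step of the tower. -/

namespace KummerTower

variable {K E : Type*} [Field K] [Field E] [Algebra K E] {x : ℕ → E}

theorem ramificationIndex_step (hx : IsGeneratingSequence K x) (hK : 2 < Nat.card K) {n T : ℕ}
    (hT : T ≤ n) {α : K} (hα0 : α ≠ 0) (hα1 : α ≠ -1) {Q : Place K (level K x n)}
    (hQ : Q.IsZero (gen K x hT - algebraMap K (level K x n) α))
    {Q' : Place K (level K x (n + 1))} (hQ' : Place.LiesOver (step K x n) Q' Q) :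
    Place.ramificationIndex (step K x n) Q' = if n < 2 * T then 1 else Nat.card K - 1 := by
  -- A single valuation of `E` restricts, up to equivalence, to those of `Q'` and `Q`, so all levels
  -- are compared inside `E`.
  obtain ⟨A, hA⟩ := Place.exists_comap_eq Q'.ring (algebraMap (level K x (n + 1)) E)
  have hequiv : (A.valuation.comap (algebraMap (level K x (n + 1)) E)).IsEquiv
      Q'.ring.valuation := by
    rw [Valuation.isEquiv_iff_valuationSubring, ValuationSubring.valuationSubring_valuation, ← hA]
    ext z
    exact A.valuation_le_one_iff _
  have hequivQ : (A.valuation.comap (algebraMap (level K x n) E)).IsEquiv Q.ring.valuation := by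
    rw [Valuation.isEquiv_iff_valuationSubring, ValuationSubring.valuationSubring_valuation, ← hQ',
      ← hA]
    ext z
    exact A.valuation_le_one_iff _
  have h : IsZeroAt K x A.valuation T α :=
    { generating := hx
      card := hK
      le_one := fun c => by
        have := Q'.algebraMap_mem c
        rw [← hA] at this
        exact (A.valuation_le_one_iff _).mpr this
      ne_zero := hα0
      ne_neg_one := hα1
      lt_one := hequivQ.lt_one_iff_lt_one.mpr hQ }
  have hzpow : ∀ {z w : level K x (n + 1)} {k : ℤ},
      A.valuation z = A.valuation w ^ k → Q'.ring.valuation z = Q'.ring.valuation w ^ k := by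
    intro z w k hzw
    rw [← map_zpow₀] at hzw ⊢
    exact hequiv.eq_iff.mp hzw
  have hlt : ∀ {z : level K x (n + 1)}, A.valuation z < 1 → Q'.ring.valuation z < 1 :=
    fun hz => hequiv.lt_one_iff_lt_one.mp hz
  split_ifs with hn
  · have hb0 := h.centered_zero_ne_zero
    -- As `n + 1 ≤ 2T`, `b` is a uniformizer at both levels, so `e = 1`.
    refine Place.ramificationIndex_eq (step K x n) Q'
      (ϖ := ⟨centered x T α 0, centered_mem x T α (Nat.zero_le _)⟩)
      (a := ⟨centered x T α 0, centered_mem x T α (Nat.zero_le _)⟩)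
      (fun h0 => hb0 (congrArg Subtype.val h0)) (hlt (h.centered_lt_one 0))
      (fun z hz => ?_) (fun h0 => hb0 (congrArg Subtype.val h0)) (pow_one _).symm
      (fun c hc => ?_)
    · obtain ⟨k, hk⟩ := h.exists_zpow_of_le (i := n + 1) hn z.2 (by simpa using hz)
      exact ⟨k, hzpow hk⟩
    · obtain ⟨k, hk⟩ := h.exists_zpow_of_le (i := n) hn.le c.2 (by simpa using hc)
      exact ⟨k, hzpow hk⟩
  · have hb0 := h.centered_ne_zero_of_ge hT
    have hb1 := h.centered_ne_zero_of_ge (hT.trans n.le_succ)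
    -- Here `2T ≤ n`: the uniformizers are the centered generators of index `n + 1` and `n`, and `e
    -- = q - 1`.
    refine Place.ramificationIndex_eq (step K x n) Q'
      (ϖ := ⟨centered x T α (n + 1), centered_mem x T α le_rfl⟩)
      (a := ⟨centered x T α n, centered_mem x T α le_rfl⟩)
      (fun h0 => hb1 (congrArg Subtype.val h0)) (hlt (h.centered_lt_one (n + 1)))
      (fun z hz => ?_) (fun h0 => hb0 (congrArg Subtype.val h0)) ?_
      (fun c hc => ?_)
    · obtain ⟨k, hk⟩ := h.exists_zpow_of_ge (i := n + 1) (by omega) z.2 (by simpa using hz)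
      exact ⟨k, hzpow hk⟩
    · have := (h.pow_centered_of_le hT (h.centered_lt_one n)).symm
      rw [← zpow_natCast] at this ⊢
      exact hzpow this
    · obtain ⟨k, hk⟩ := h.exists_zpow_of_ge (i := n) (by omega) c.2 (by simpa using hc)
      exact ⟨k, hzpow hk⟩

end KummerTower

theorem lemma2p3 {K E : Type*} [Field K] [Field E] [Algebra K E]
    (q : ℕ) (hq : 2 < q) (hK : Nat.card K = q)
    (x : ℕ → E) (hx : KummerTower.IsGeneratingSequence K x)
    (n : ℕ) (t : ℤ) (ht : -1 ≤ t) (htn : t < n)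
    (α : K) (hα0 : α ≠ 0) (hα1 : α ≠ -1)
    (Q : Place K (KummerTower.level K x n))
    (hQ : Q.IsZero (KummerTower.gen K x (i := (t + 1).toNat) (by omega)
      - algebraMap K (KummerTower.level K x n) α)) :
    ((n : ℤ) < 2 * t + 2 → Q.IsUnramifiedIn (KummerTower.step K x n)) ∧
    (2 * t + 2 ≤ (n : ℤ) →
      Q.IsRamifiedIn (KummerTower.step K x n) ∧
      ∀ Q' : Place K (KummerTower.level K x (n + 1)),
        Place.LiesOver (KummerTower.step K x n) Q' Q →
          Place.ramificationIndex (KummerTower.step K x n) Q' = q - 1) := by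
  subst hK
  -- Since `-1 ≤ t`, `toNat` does not truncate, and `n < 2T` means `n < 2t + 2`.
  have key := fun Q' hQ' => KummerTower.ramificationIndex_step (Q' := Q') hx hq
    (show (t + 1).toNat ≤ n by omega) hα0 hα1 hQ hQ'
  refine ⟨fun hn Q' hQ' => ?_, fun hn => ?_⟩
  · rw [key Q' hQ', if_pos (by omega)]
  · have hram : ∀ Q', Place.LiesOver (KummerTower.step K x n) Q' Q →
        Place.ramificationIndex (KummerTower.step K x n) Q' = Nat.card K - 1 := fun Q' hQ' => by
      rw [key Q' hQ', if_neg (by omega)]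
    -- Being ramified requires some place over `Q` to exist; its index `q - 1` exceeds 1 because `q
    -- > 2`.
    obtain ⟨Q', hQ'⟩ := Place.exists_liesOver (KummerTower.step K x n) Q
    exact ⟨⟨Q', hQ', by rw [hram Q' hQ']; omega⟩, hram⟩
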